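/- **Setting.** For each precision $p\in\mathbb N$ let $S_p$ be a finite set of extended reals containing $\pm\infty$, with $S_p\subseteq S_q$ for $p\le q$. Let $R_p^\downarrow,R_p^\uparrow$ denote rounding down and up to $S_p$. An interval at precision $p$ is a pair $a\le b$ in $S_p$ with a flag on each endpoint saying whether that endpoint is *immovable* or *movable*. An interval $[a',b']$ *refines* $[a,b]$, written $[a',b']\prec[a,b]$, if ($b'=b$ and both are immovable, or $b'\le b$ and $b$ is movable) and ($a'=a$ and both are immovable, or $a'\ge a$ and $a$ is movable). A *hyperrectangle* $X$ at precision $p$ assigns such an interval to each of $n$ variables, and $X'\prec X$ is meant pointwise. A point $x$ with all coordinates in $S_p$ is identified, at precision $p$, with the hyperrectangle of intervals $[x_i,x_i]$ with both endpoints immovable. Expressions $e$ are built from variables, real constants and operator applications. The interval value $[\![e]\!]_p(X)$ at precision $p$ is computed recursively: a variable gives its interval in $X$; a constant $c$ gives $[R_p^\downarrow(c),R_p^\uparrow(c)]$, with both endpoints immovable if $c\in S_p$ and both movable otherwise; an operator $f$ is applied through maps $f_p$ from intervals to an interval at precision $p$. Each operator is of one of two kinds: * a *standard* one: for some function $f$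 from $k$-tuples of extended reals to extended reals, $f_p(I_1,\dots,I_k)=[R_p^\downarrow(\inf f),R_p^\uparrow(\sup f)]$ (inf and sup over the box $I_1\times\dots\times I_k$), where the left (right) endpoint $c$ is immovable exactly when there are a point $w$ of the box and a set $K$ of coordinates such that for each $i\in K$ either $w_i$ is an immovable endpoint of $I_i$ or both endpoints of $I_i$ are immovable, and such that for all $x$ in the box with $x_i=w_i$ for $i\in K$, and all $q\ge p$, $R_q^\downarrow(f(x))=c$ (respectively $R_q^\uparrow(f(x))=c$); * or any other operator that preserves refinement: $f_q(I_1',\dots,I_k')\prec f_p(I_1,\dots,I_k)$ whenever $q>p$ and $I_i'\prec I_i$ for all $i$. Fix a target precision $t$ and a rounding $R$ to $S_t$, that is, a monotone map with $R(x)\in\{R_t^\downarrow(x),R_t^\uparrow(x)\}$ for all $x$. An interval $[a,b]$ is *one-value* if $R(a)=R(b)$, and *stuck* if both its endpoints are immovable and it is not one-value. **Theorem.** Suppose that $[\![e]\!]_p(X)$ is stuck, for a hyperrectangle $X$ at precision $p$. Then for every precision $q>p$ and every hyperrectangle $X'$ at precision $q$ with $X'\prec X$, $[\![e]\!]_q(X')$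 is stuck. **Corollary.** If moreover both endpoints of every interval of $X$ are movable, then every point $x\in X$ whose coordinates all belong to some $S_r$ is unsamplable: $[\![e]\!]_q(x)$ is stuck at every precision $q>p$ at which $x$ is representable, of which there is at least one, and $[\![e]\!]_r(x)$ is one-value at no precision $r$ at which $x$ is representable. -/

import Mathlib

noncomputable section

namespace Movability

/-- Arbitrary-precision floating point: at each precision `p`, a finite set `S p` of representable
extended reals that contains the two infinities; whatever is representable at one precision is
representable at all higher ones. -/
structure FloatSystem where
  S : ℕ → Set EReal
  finite : ∀ p, (S p).Finite
  bot_mem : ∀ p, ⊥ ∈ S p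
  top_mem : ∀ p, ⊤ ∈ S p
  mono : ∀ p q, p ≤ q → S p ⊆ S q

/-- Rounding down: the largest element of `s` that is at most `x`. -/
def roundDown (s : Set EReal) (x : EReal) : EReal := sSup {y ∈ s | y ≤ x}

/-- Rounding up: the smallest element of `s` that is at least `x`. -/
def roundUp (s : Set EReal) (x : EReal) : EReal := sInf {y ∈ s | x ≤ y}

theorem roundDown_le (s : Set EReal) (x : EReal) : roundDown s x ≤ x :=
  sSup_le fun _ hy => hy.2

theorem le_roundUp (s : Set EReal) (x : EReal) : x ≤ roundUp s x :=
  le_sInf fun _ hy => hy.2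

theorem FloatSystem.roundDown_mem (F : FloatSystem) (p : ℕ) (x : EReal) :
    roundDown (F.S p) x ∈ F.S p := by
  have hne : {y ∈ F.S p | y ≤ x}.Nonempty := ⟨⊥, F.bot_mem p, bot_le⟩
  have hfin : {y ∈ F.S p | y ≤ x}.Finite := (F.finite p).subset fun y hy => hy.1
  exact (hne.csSup_mem hfin).1

theorem FloatSystem.roundUp_mem (F : FloatSystem) (p : ℕ) (x : EReal) :
    roundUp (F.S p) x ∈ F.S p := by
  have hne : {y ∈ F.S p | x ≤ y}.Nonempty := ⟨⊤, F.top_mem p, le_top⟩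
  have hfin : {y ∈ F.S p | x ≤ y}.Finite := (F.finite p).subset fun y hy => hy.1
  exact (hne.csInf_mem hfin).1

/-- A rounding function into `s`: monotone, and choosing for each `x` one of the two neighbours
of `x` in `s` (for instance, rounding to nearest). -/
def IsRounding (s : Set EReal) (R : EReal → EReal) : Prop :=
  Monotone R ∧ ∀ x, R x = roundDown s x ∨ R x = roundUp s x

/-- A closed interval `[lo, hi]` with endpoints in `s` and a movability flag on each endpoint;
`loImm` (`hiImm`) says that the flag is set, that is, that the endpoint is immovable. -/
structure FlaggedInterval (s : Set EReal) where
  lo : EReal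
  hi : EReal
  lo_mem : lo ∈ s
  hi_mem : hi ∈ s
  le : lo ≤ hi
  loImm : Prop
  hiImm : Prop

/-- `Refines J I` is `J ≺ I`. -/
def Refines {s' s : Set EReal} (J : FlaggedInterval s') (I : FlaggedInterval s) : Prop :=
  ((J.hi = I.hi ∧ J.hiImm ∧ I.hiImm) ∨ (J.hi ≤ I.hi ∧ ¬ I.hiImm)) ∧
  ((J.lo = I.lo ∧ J.loImm ∧ I.loImm) ∨ (I.lo ≤ J.lo ∧ ¬ I.loImm))

/-- The interval is narrow enough to determine the value rounded by the target rounding `R`. -/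
def OneValue (R : EReal → EReal) {s : Set EReal} (I : FlaggedInterval s) : Prop :=
  R I.lo = R I.hi

/-- Both endpoints are immovable, but the interval is not one-value. -/
def Stuck (R : EReal → EReal) {s : Set EReal} (I : FlaggedInterval s) : Prop :=
  I.loImm ∧ I.hiImm ∧ ¬ OneValue R I

/-- A hyperrectangle at precision `p`: an interval for each of `n` variables. -/
abbrev Hyperrect (F : FloatSystem) (n p : ℕ) : Type := Fin n → FlaggedInterval (F.S p)

/-- Pointwise refinement of hyperrectangles, possibly at different precisions. -/
def RefinesBox {F : FloatSystem} {n q p : ℕ} (Y : Hyperrect F n q) (X : Hyperrect F n p) : Prop :=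
  ∀ i, Refines (Y i) (X i)

/-- The set of points of a hyperrectangle. -/
def points {F : FloatSystem} {n p : ℕ} (X : Hyperrect F n p) : Set (Fin n → EReal) :=
  {x | ∀ i, (X i).lo ≤ x i ∧ x i ≤ (X i).hi}

/-- A representable input point `x` as the hyperrectangle of the intervals `[!x i, x i!]`. -/
def pointBox (F : FloatSystem) {n : ℕ} (p : ℕ) (x : Fin n → EReal) (hx : ∀ i, x i ∈ F.S p) :
    Hyperrect F n p :=
  fun i => ⟨x i, x i, hx i, hx i, le_rfl, True, True⟩

/-- A `k`-ary interval operator: for each precision `p`, a map from `k` flagged intervals to a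
flagged interval, all with endpoints representable at precision `p`. -/
abbrev IntervalOp (F : FloatSystem) (k : ℕ) : Type :=
  ∀ p, Hyperrect F k p → FlaggedInterval (F.S p)

/-- The operator preserves refinement of its inputs under an increase of precision. -/
def PreservesRefinement {F : FloatSystem} {k : ℕ} (op : IntervalOp F k) : Prop :=
  ∀ p q, p < q → ∀ (I : Hyperrect F k p) (J : Hyperrect F k q),
    RefinesBox J I → Refines (op q J) (op p I)

/-- The flags of `I` guarantee that the number `w` of `I` belongs to all refinements of `I`:
it is an immovable endpoint, or both endpoints are immovable. -/
def Pinned {s : Set EReal} (I : FlaggedInterval s) (w : EReal) : Prop :=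
  (w = I.lo ∧ I.loImm) ∨ (w = I.hi ∧ I.hiImm) ∨ (I.loImm ∧ I.hiImm)

/-- Given the set `A` of points of an input box `I` and a function `g` with values rounded at
each precision (`g q x` is the value at `x`, rounded at precision `q`), the endpoint `c` is forced
at precision `p`: some coordinates, set to pinned values, make the rounded value `c` at all
precisions from `p` on, whatever the other coordinates are. With all coordinates pinned and an
exactly representable value this is the rule for exact results on immovable inputs; with a value
beyond the finite range it is the overflow rule (with no coordinate pinned, if all values in the
box overflow); with some coordinates pinned it contains the rules for a product with an
immovable zero, and for sums and products with an immovable infinity. -/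
def Forced {F : FloatSystem} {k p : ℕ} (I : Hyperrect F k p)
    (g : ℕ → (Fin k → EReal) → EReal) (c : EReal) : Prop :=
  ∃ w ∈ points I, ∃ K : Set (Fin k), (∀ i ∈ K, Pinned (I i) (w i)) ∧
    ∀ x ∈ points I, (∀ i ∈ K, x i = w i) → ∀ q, p ≤ q → g q x = c

/-- The standard interval version of a function `f` on the extended reals: the range of `f` on the
input box, rounded outward, with an endpoint marked immovable exactly if the flags of the inputs
force it. -/
def standardOp (F : FloatSystem) {k : ℕ} (f : (Fin k → EReal) → EReal) : IntervalOp F k :=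
  fun p I =>
    { lo := roundDown (F.S p) (sInf (f '' points I))
      hi := roundUp (F.S p) (sSup (f '' points I))
      lo_mem := F.roundDown_mem p _
      hi_mem := F.roundUp_mem p _
      le := by
        have hne : (f '' points I).Nonempty := ⟨_, fun i => (I i).lo, fun i => ⟨le_rfl, (I i).le⟩, rfl⟩
        exact ((roundDown_le _ _).trans (sInf_le_sSup hne)).trans (le_roundUp _ _)
      loImm := Forced I (fun q x => roundDown (F.S q) (f x))
        (roundDown (F.S p) (sInf (f '' points I)))
      hiImm := Forced I (fun q x => roundUp (F.S q) (f x))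
        (roundUp (F.S p) (sSup (f '' points I))) }

/-- The interval operators that expressions may use: the standard interval version of any
function, and any other operator, with whatever rule for its endpoints and its flags, that
preserves refinement. -/
def Admissible {F : FloatSystem} {k : ℕ} (op : IntervalOp F k) : Prop :=
  (∃ f : (Fin k → EReal) → EReal, op = standardOp F f) ∨ PreservesRefinement op

/-- Expressions in `n` variables: variables, real constants, and applications of operator symbols
`o : O` with arities `ar o`. -/
inductive Expr (O : Type*) (ar : O → ℕ) (n : ℕ) where
  | var (i : Fin n) : Expr O ar n
  | const (c : ℝ) : Expr O ar n
  | app (o : O) (args : Fin (ar o) → Expr O ar n) : Expr O ar n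

/-- A constant at precision `p`: rounded outward, and immovable exactly if it is representable. -/
def constInterval (F : FloatSystem) (p : ℕ) (c : ℝ) : FlaggedInterval (F.S p) where
  lo := roundDown (F.S p) c
  hi := roundUp (F.S p) c
  lo_mem := F.roundDown_mem p _
  hi_mem := F.roundUp_mem p _
  le := (roundDown_le _ _).trans (le_roundUp _ _)
  loImm := (c : EReal) ∈ F.S p
  hiImm := (c : EReal) ∈ F.S p

/-- Interval evaluation of an expression at precision `p` on a hyperrectangle, where `lib`
interprets the operator symbols. -/
def eval {F : FloatSystem} {O : Type*} {ar : O → ℕ} {n : ℕ} (lib : ∀ o, IntervalOp F (ar o))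
    (p : ℕ) (X : Hyperrect F n p) : Expr O ar n → FlaggedInterval (F.S p)
  | .var i => X i
  | .const c => constInterval F p c
  | .app o args => lib o p fun j => eval lib p X (args j)

/-- The point `x` is unsamplable for `e`: evaluation at `x` gets stuck at some precision, and it
gives a one-value interval at no precision. -/
def Unsamplable {F : FloatSystem} {O : Type*} {ar : O → ℕ} {n : ℕ}
    (lib : ∀ o, IntervalOp F (ar o)) (R : EReal → EReal) (e : Expr O ar n)
    (x : Fin n → EReal) : Prop :=
  (∃ (q : ℕ) (hx : ∀ i, x i ∈ F.S q), Stuck R (eval lib q (pointBox F q x hx) e)) ∧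
  ∀ (r : ℕ) (hx : ∀ i, x i ∈ F.S r), ¬ OneValue R (eval lib r (pointBox F r x hx) e)

end Movability

end

namespace Movability

/-! Interval evaluation is monotone for refinement (`refines_eval`, by induction on the expression),
and a refinement keeps immovable endpoints in place and immovable. So a stuck value stays stuck.

The substance is the case of a standard operator (`preservesRefinement_standardOp`): pinned numbers
survive refinement, so a forced endpoint is still attained at some point of the smaller box, and the
new endpoint can move neither outward nor inward past it.

For the corollary, each representable point of an all-movable box refines it, so evaluation there is
stuck at every precision above `p`. A one-value result at any precision would persist at higher
ones, where it contradicts stuckness. -/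

theorem roundUp_le_roundUp {s s' : Set EReal} (h : s ⊆ s') {x y : EReal} (hxy : x ≤ y) :
    roundUp s' x ≤ roundUp s y :=
  sInf_le_sInf fun _ hz => ⟨h hz.1, hxy.trans hz.2⟩

theorem roundDown_le_roundDown {s s' : Set EReal} (h : s ⊆ s') {x y : EReal} (hxy : x ≤ y) :
    roundDown s x ≤ roundDown s' y :=
  sSup_le_sSup fun _ hz => ⟨h hz.1, hz.2.trans hxy⟩

theorem roundUp_eq_self {s : Set EReal} {x : EReal} (h : x ∈ s) : roundUp s x = x :=
  le_antisymm (sInf_le ⟨h, le_rfl⟩) (le_roundUp s x)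

theorem roundDown_eq_self {s : Set EReal} {x : EReal} (h : x ∈ s) : roundDown s x = x :=
  le_antisymm (roundDown_le s x) (le_sSup ⟨h, le_rfl⟩)

namespace Refines

variable {s s' : Set EReal} {J : FlaggedInterval s'} {I : FlaggedInterval s}

theorem hi_le (h : Refines J I) : J.hi ≤ I.hi :=
  h.1.elim (fun h => h.1.le) fun h => h.1

theorem lo_le (h : Refines J I) : I.lo ≤ J.lo :=
  h.2.elim (fun h => h.1.ge) fun h => h.1

theorem hi_eq (h : Refines J I) (hI : I.hiImm) : J.hi = I.hi ∧ J.hiImm :=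
  h.1.elim (fun h => ⟨h.1, h.2.1⟩) fun h => absurd hI h.2

theorem lo_eq (h : Refines J I) (hI : I.loImm) : J.lo = I.lo ∧ J.loImm :=
  h.2.elim (fun h => ⟨h.1, h.2.1⟩) fun h => absurd hI h.2

/-- To refine an interval, it suffices to shrink it while fixing its immovable endpoints and
keeping them immovable. -/
theorem of_imp (hlo : I.lo ≤ J.lo) (hhi : J.hi ≤ I.hi)
    (hlo' : I.loImm → J.lo = I.lo ∧ J.loImm) (hhi' : I.hiImm → J.hi = I.hi ∧ J.hiImm) :
    Refines J I := by
  constructor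
  · by_cases h : I.hiImm
    · exact .inl ⟨(hhi' h).1, (hhi' h).2, h⟩
    · exact .inr ⟨hhi, h⟩
  · by_cases h : I.loImm
    · exact .inl ⟨(hlo' h).1, (hlo' h).2, h⟩
    · exact .inr ⟨hlo, h⟩

/-- A pinned number of an interval survives in every refinement, and stays pinned there. -/
theorem pinned (h : Refines J I) {w : EReal} (hw : I.lo ≤ w ∧ w ≤ I.hi) (hp : Pinned I w) :
    (J.lo ≤ w ∧ w ≤ J.hi) ∧ Pinned J w := by
  rcases hp with ⟨rfl, hi⟩ | ⟨rfl, hi⟩ | ⟨hl, hi⟩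
  · obtain ⟨he, hJ⟩ := h.lo_eq hi
    exact ⟨⟨he.le, he ▸ J.le⟩, .inl ⟨he.symm, hJ⟩⟩
  · obtain ⟨he, hJ⟩ := h.hi_eq hi
    exact ⟨⟨he ▸ J.le, he.ge⟩, .inr (.inl ⟨he.symm, hJ⟩)⟩
  · obtain ⟨hel, hJl⟩ := h.lo_eq hl
    obtain ⟨heh, hJh⟩ := h.hi_eq hi
    exact ⟨⟨hel.le.trans hw.1, hw.2.trans heh.ge⟩, .inr (.inr ⟨hJl, hJh⟩)⟩

/-- Stuckness is inherited by refinements. -/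
theorem stuck (h : Refines J I) {R : EReal → EReal} (hI : Stuck R I) : Stuck R J := by
  obtain ⟨hl, hh, hne⟩ := hI
  refine ⟨(h.lo_eq hl).2, (h.hi_eq hh).2, ?_⟩
  simpa only [OneValue, (h.lo_eq hl).1, (h.hi_eq hh).1] using hne

/-- Being one-value for a monotone rounding is inherited by refinements. -/
theorem oneValue (h : Refines J I) {R : EReal → EReal} (hR : Monotone R) (hI : OneValue R I) :
    OneValue R J :=
  le_antisymm (hR J.le) <|
    (hR h.hi_le).trans <| (show R I.hi = R I.lo from hI.symm).le.trans (hR h.lo_le)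

end Refines

variable {F : FloatSystem}

theorem RefinesBox.points_subset {n p q : ℕ} {J : Hyperrect F n q} {I : Hyperrect F n p}
    (h : RefinesBox J I) : points J ⊆ points I :=
  fun _ hx i => ⟨(h i).lo_le.trans (hx i).1, (hx i).2.trans (h i).hi_le⟩

theorem Forced.of_refinesBox {k p q : ℕ} (hpq : p ≤ q) {I : Hyperrect F k p} {J : Hyperrect F k q}
    (h : RefinesBox J I) {g : ℕ → (Fin k → EReal) → EReal} {c : EReal} (hI : Forced I g c) :
    Forced J g c := by
  classical
  obtain ⟨w, hw, K, hK, hc⟩ := hI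
  -- Off `K` the old witness may lie outside `J`, but its values there are irrelevant: any number of
  -- `J i` will do.
  refine ⟨fun i => if i ∈ K then w i else (J i).lo, fun i => ?_, K, fun i hi => ?_,
    fun x hx hxw r hr => hc x (h.points_subset hx) (fun i hi => ?_) r (hpq.trans hr)⟩
  · by_cases hi : i ∈ K
    · simpa only [if_pos hi] using ((h i).pinned (hw i) (hK i hi)).1
    · simpa only [if_neg hi] using ⟨le_rfl, (J i).le⟩
  · simpa only [if_pos hi] using ((h i).pinned (hw i) (hK i hi)).2
  · simpa only [if_pos hi] using hxw i hi

/-- A forced value is taken at some point of the box. -/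
theorem Forced.exists_eq {k p : ℕ} {I : Hyperrect F k p} {g : ℕ → (Fin k → EReal) → EReal}
    {c : EReal} (h : Forced I g c) : ∃ w ∈ points I, g p w = c := by
  obtain ⟨w, hw, K, -, hc⟩ := h
  exact ⟨w, hw, hc w hw (fun _ _ => rfl) p le_rfl⟩

/-- Shrinking the box and refining the grid can only move endpoints inward. If the lower endpoint
`c` is forced, some `w` in the smaller box has `f w` rounding down to `c` at precision `q`; the
infimum is at most `f w`, so the new endpoint is also at most `c`. The upper endpoint is dual. -/
theorem preservesRefinement_standardOp {k : ℕ} (f : (Fin k → EReal) → EReal) :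
    PreservesRefinement (standardOp F f) := by
  intro p q hpq I J h
  have hS := F.mono p q hpq.le
  have himg : f '' points J ⊆ f '' points I := Set.image_mono h.points_subset
  have hlo : (standardOp F f p I).lo ≤ (standardOp F f q J).lo :=
    roundDown_le_roundDown hS (sInf_le_sInf himg)
  have hhi : (standardOp F f q J).hi ≤ (standardOp F f p I).hi :=
    roundUp_le_roundUp hS (sSup_le_sSup himg)
  refine Refines.of_imp hlo hhi (fun hI => ?_) fun hI => ?_
  · have hJ := Forced.of_refinesBox hpq.le h hI
    obtain ⟨w, hw, hwc⟩ := hJ.exists_eq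
    have he : (standardOp F f q J).lo = (standardOp F f p I).lo :=
      le_antisymm ((roundDown_le_roundDown subset_rfl
        (sInf_le (Set.mem_image_of_mem f hw))).trans hwc.le) hlo
    -- `hJ` forces the old endpoint, whereas the flag of the new interval asks that its own endpoint
    -- be forced; `he` identifies the two.
    exact ⟨he, by rw [← show _ = roundDown (F.S p) _ from he] at hJ; exact hJ⟩
  · have hJ := Forced.of_refinesBox hpq.le h hI
    obtain ⟨w, hw, hwc⟩ := hJ.exists_eq
    have he : (standardOp F f q J).hi = (standardOp F f p I).hi :=
      le_antisymm hhi (hwc.ge.trans (roundUp_le_roundUp subset_rfl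
        (le_sSup (Set.mem_image_of_mem f hw))))
    exact ⟨he, by rw [← show _ = roundUp (F.S p) _ from he] at hJ; exact hJ⟩

theorem Admissible.preservesRefinement {k : ℕ} {op : IntervalOp F k} (h : Admissible op) :
    PreservesRefinement op := by
  rcases h with ⟨f, rfl⟩ | h
  · exact preservesRefinement_standardOp f
  · exact h

theorem refines_constInterval {p q : ℕ} (hpq : p ≤ q) (c : ℝ) :
    Refines (constInterval F q c) (constInterval F p c) := by
  have hS := F.mono p q hpq
  refine Refines.of_imp (roundDown_le_roundDown hS le_rfl) (roundUp_le_roundUp hS le_rfl)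
    (fun h => ⟨?_, hS h⟩) fun h => ⟨?_, hS h⟩
  · exact (roundDown_eq_self (hS h)).trans (roundDown_eq_self h).symm
  · exact (roundUp_eq_self (hS h)).trans (roundUp_eq_self h).symm

/-- Interval evaluation preserves refinement under an increase of precision. -/
theorem refines_eval {O : Type*} {ar : O → ℕ} {lib : ∀ o, IntervalOp F (ar o)}
    (hlib : ∀ o, PreservesRefinement (lib o)) {n p q : ℕ} (hpq : p < q)
    {X : Hyperrect F n p} {X' : Hyperrect F n q} (h : RefinesBox X' X) (e : Expr O ar n) :
    Refines (eval lib q X' e) (eval lib p X e) := by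
  induction e with
  | var i => simpa only [eval] using h i
  | const c => simpa only [eval] using refines_constInterval hpq.le c
  | app o args ih => simpa only [eval] using hlib o p q hpq _ _ ih

/-- At a movable endpoint refinement asks only for containment, whatever the new flag. -/
theorem refinesBox_pointBox_of_movable {n p q : ℕ} {X : Hyperrect F n p}
    (hX : ∀ i, ¬ (X i).loImm ∧ ¬ (X i).hiImm) {x : Fin n → EReal} (hx : x ∈ points X)
    (hq : ∀ i, x i ∈ F.S q) : RefinesBox (pointBox F q x hq) X :=
  fun i => ⟨.inr ⟨(hx i).2, (hX i).2⟩, .inr ⟨(hx i).1, (hX i).1⟩⟩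

theorem refinesBox_pointBox_pointBox {n p q : ℕ} {x : Fin n → EReal} (hp : ∀ i, x i ∈ F.S p)
    (hq : ∀ i, x i ∈ F.S q) : RefinesBox (pointBox F q x hq) (pointBox F p x hp) :=
  fun _ => ⟨.inl ⟨rfl, trivial, trivial⟩, .inl ⟨rfl, trivial, trivial⟩⟩

end Movability

theorem theorem2 (F : Movability.FloatSystem)
    -- the operators of the expressions
    {O : Type*} {ar : O → ℕ} (lib : ∀ o, Movability.IntervalOp F (ar o))
    (hlib : ∀ o, Movability.Admissible (lib o))
    -- the target precision and its rounding
    (t : ℕ) (R : EReal → EReal) (hR : Movability.IsRounding (F.S t) R)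
    {n : ℕ} (e : Movability.Expr O ar n)
    (p : ℕ) (X : Movability.Hyperrect F n p)
    (hstuck : Movability.Stuck R (Movability.eval lib p X e)) :
    (∀ (q : ℕ) (X' : Movability.Hyperrect F n q), p < q → Movability.RefinesBox X' X →
      Movability.Stuck R (Movability.eval lib q X' e)) ∧
    ((∀ i, ¬ (X i).loImm ∧ ¬ (X i).hiImm) →
      ∀ x ∈ Movability.points X, (∃ r, ∀ i, x i ∈ F.S r) →
        Movability.Unsamplable lib R e x ∧
        ∀ (q : ℕ) (hx : ∀ i, x i ∈ F.S q), p < q →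
          Movability.Stuck R (Movability.eval lib q (Movability.pointBox F q x hx) e)) := by
  have hop := fun o => (hlib o).preservesRefinement
  have hmain : ∀ (q : ℕ) (X' : Movability.Hyperrect F n q), p < q → Movability.RefinesBox X' X →
      Movability.Stuck R (Movability.eval lib q X' e) :=
    fun q X' hpq h => (Movability.refines_eval hop hpq h e).stuck hstuck
  refine ⟨hmain, fun hX x hx hrep => ?_⟩
  have hpoint : ∀ (q : ℕ) (hq : ∀ i, x i ∈ F.S q), p < q →
      Movability.Stuck R (Movability.eval lib q (Movability.pointBox F q x hq) e) :=
    fun q hq hpq => hmain q _ hpq (Movability.refinesBox_pointBox_of_movable hX hx hq)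
  -- The precision `p + r + 1` strictly exceeds both `p`, so that `hpoint` applies, and `r`, so that
  -- a one-value result at `r` carries over to it.
  have hmono : ∀ {r}, (∀ i, x i ∈ F.S r) → ∀ i, x i ∈ F.S (p + r + 1) :=
    fun hr i => F.mono _ _ (by omega) (hr i)
  obtain ⟨r, hr⟩ := hrep
  refine ⟨⟨⟨_, hmono hr, hpoint _ (hmono hr) (by omega)⟩, fun r hr hone => ?_⟩, hpoint⟩
  have href := Movability.refinesBox_pointBox_pointBox hr (hmono hr)
  exact (hpoint _ (hmono hr) (by omega)).2.2
    ((Movability.refines_eval hop (by omega) href e).oneValue hR.1 hone)
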